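/- For elements $a,b$ of a group write $[a,b]=a^{-1}b^{-1}ab$ and $[a,b,c]=[[a,b],c]$; for subgroups $A,B$ let $[A,B]$ be the subgroup generated by all $[a,b]$ with $a\in A$, $b\in B$, and $[A,B,C]=[[A,B],C]$. Let $F_3$ be the free group on $f_1,f_2,f_3$, let $F_3''$ be its second derived subgroup, and put $G_3=F_3/[F_3'',F_3,F_3]$, $C_3=F_3/[F_3'',F_3]$ and $x_i=f_i[F_3'',F_3,F_3]\in G_3$ for $i=1,2,3$. Let $T_3$ be the image of the natural homomorphism $\mathrm{Aut}(F_3)\to\mathrm{Aut}(G_3)$ (the group of tame automorphisms), and let $H_3$ be the kernel of the homomorphism $\mathrm{Aut}(G_3)\to\mathrm{Aut}(C_3)$ induced by the natural map $G_3\to C_3$. Then there are automorphisms $\alpha_1,\alpha_2$ of $G_3$ with $$\alpha_1(x_1)=x_1\,[[x_1,x_2],[x_1,x_3],x_1],\qquad \alpha_2(x_1)=x_1\,[[x_1,x_2],[x_1,x_3],x_2],$$ and $\alpha_1(x_j)=\alpha_2(x_j)=x_j$ for $j=2,3$ (they are unique, since $x_1,x_2,x_3$ generate $G_3$), and $H_3$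 is the normal closure of $\{\alpha_1,\alpha_2\}$ under $T_3$, that is, $$H_3=\langle\, \tau^{-1}\alpha_i\tau : \tau\in T_3,\ i\in\{1,2\}\,\rangle .$$ -/

import Mathlib

namespace AutG3

/-- The commutator with the convention `[a, b] = a⁻¹ b⁻¹ a b`. -/
def comm {G : Type*} [Group G] (a b : G) : G := a⁻¹ * b⁻¹ * a * b

/-- `⟨X⟩^K`: the subgroup generated by all `y⁻¹ x y` with `y ∈ K` and `x ∈ X`. -/
def conjClosure {G : Type*} [Group G] (X : Set G) (K : Subgroup G) : Subgroup G :=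
  Subgroup.closure {z | ∃ y ∈ K, ∃ x ∈ X, z = y⁻¹ * x * y}

section Induced

variable {G Q : Type*} [Group G] [Group Q]

theorem induced_wd (p : G →* Q) (hc : p.ker.Characteristic) (θ : MulAut G) {a b : G}
    (h : p a = p b) : p (θ a) = p (θ b) := by
  have h1 : a⁻¹ * b ∈ p.ker := by simp [MonoidHom.mem_ker, h]
  have h2 : a⁻¹ * b ∈ p.ker.comap θ.toMonoidHom := by
    rw [Subgroup.characteristic_iff_comap_eq.mp hc θ]; exact h1
  have h3 : p (θ (a⁻¹ * b)) = 1 := h2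
  rw [map_mul, map_mul, map_inv, map_inv, inv_mul_eq_one] at h3
  exact h3

/-- The homomorphism `Aut(G) → Aut(Q)` induced by an epimorphism `p : G → Q` whose kernel is
characteristic: `θ` is sent to the automorphism `p g ↦ p (θ g)`. -/
noncomputable def inducedAut (p : G →* Q) (hs : Function.Surjective p)
    (hc : p.ker.Characteristic) : MulAut G →* MulAut Q where
  toFun θ :=
    { toFun := fun q => p (θ (Function.surjInv hs q))
      invFun := fun q => p (θ.symm (Function.surjInv hs q))
      left_inv := fun q => by
        have := induced_wd p hc θ⁻¹
          (Function.surjInv_eq hs (p (θ (Function.surjInv hs q))))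
        exact this.trans ((congrArg p (θ.symm_apply_apply _)).trans (Function.surjInv_eq hs q))
      right_inv := fun q => by
        have := induced_wd p hc θ
          (Function.surjInv_eq hs (p (θ.symm (Function.surjInv hs q))))
        exact this.trans ((congrArg p (θ.apply_symm_apply _)).trans (Function.surjInv_eq hs q))
      map_mul' := fun a b => by
        have : p (Function.surjInv hs (a * b))
            = p (Function.surjInv hs a * Function.surjInv hs b) := by
          simp [Function.surjInv_eq hs]
        rw [induced_wd p hc θ this, map_mul, map_mul] }
  map_one' := by
    ext q
    exact Function.surjInv_eq hs q
  map_mul' θ ψ := by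
    ext q
    exact induced_wd p hc θ (Function.surjInv_eq hs (p (ψ (Function.surjInv hs q)))).symm

/-- The defining property of the induced automorphism. -/
theorem inducedAut_apply (p : G →* Q) (hs : Function.Surjective p)
    (hc : p.ker.Characteristic) (θ : MulAut G) (g : G) :
    inducedAut p hs hc θ (p g) = p (θ g) :=
  induced_wd p hc θ (Function.surjInv_eq hs (p g))

end Induced

/-- The free group of rank three. -/
abbrev F3 : Type := FreeGroup (Fin 3)

/-- `[F₃'', F₃]`. -/
abbrev VC : Subgroup F3 := ⁅derivedSeries F3 2, (⊤ : Subgroup F3)⁆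

/-- `[F₃'', F₃, F₃]`. -/
abbrev VG : Subgroup F3 := ⁅VC, (⊤ : Subgroup F3)⁆

/-- The free centre-by-metabelian group of rank three, `C₃ = F₃ / [F₃'', F₃]`. -/
abbrev C3 : Type := F3 ⧸ VC

/-- The free centre-by-centre-by-metabelian group of rank three,
`G₃ = F₃ / [F₃'', F₃, F₃]`. -/
abbrev G3 : Type := F3 ⧸ VG

/-- The free generators of `G₃`, numbered `0, 1, 2`. -/
def x (i : Fin 3) : G3 := QuotientGroup.mk' VG (FreeGroup.of i)

theorem VG_le_VC : VG ≤ VC := Subgroup.commutator_le_left _ _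

/-- The natural map `G₃ → C₃`. -/
def natGC : G3 →* C3 := QuotientGroup.map VG VC (MonoidHom.id F3) VG_le_VC

theorem natGC_surjective : Function.Surjective natGC := fun q => by
  obtain ⟨f, rfl⟩ := QuotientGroup.mk_surjective q
  exact ⟨QuotientGroup.mk f, rfl⟩

theorem natGC_ker : natGC.ker = ⁅derivedSeries G3 2, (⊤ : Subgroup G3)⁆ := by
  have hs := QuotientGroup.mk'_surjective VG
  have h1 : natGC.ker = VC.map (QuotientGroup.mk' VG) :=
    (QuotientGroup.ker_map VG VC (MonoidHom.id F3) VG_le_VC).trans (by rw [Subgroup.comap_id])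
  rw [h1, Subgroup.map_commutator, map_derivedSeries_eq hs, Subgroup.map_top_of_surjective _ hs]

theorem natGC_ker_characteristic : natGC.ker.Characteristic := by
  rw [natGC_ker]; infer_instance

theorem mkG_ker_characteristic : (QuotientGroup.mk' VG).ker.Characteristic := by
  rw [QuotientGroup.ker_mk']; infer_instance

/-- `T₃`: the tame automorphisms of `G₃`, i.e. the image of `Aut(F₃) → Aut(G₃)`. -/
noncomputable def T3 : Subgroup (MulAut G3) :=
  (inducedAut (QuotientGroup.mk' VG) (QuotientGroup.mk'_surjective VG)
    mkG_ker_characteristic).range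

/-- `φ₃ : Aut(G₃) → Aut(C₃)`, induced by the natural map `G₃ → C₃`. -/
noncomputable def phi3 : MulAut G3 →* MulAut C3 :=
  inducedAut natGC natGC_surjective natGC_ker_characteristic

/-- `H₃`: the kernel of `φ₃`. -/
noncomputable def H3 : Subgroup (MulAut G3) := phi3.ker

end AutG3

/-! The image of [F₃'', F₃] is central in G₃, so an element of `H3` multiplies each generator by a
central element and is a product of twists f ↦ f·z^χ(f), with z ∈ [F₃'', F₃] and χ : F₃ → ℤ. Twists
are additive in z and in χ, and conjugation by tame automorphisms moves both. It therefore suffices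
that the normal closure K of the two given automorphisms contains the twist by [w, y] along χ for
all w ∈ F₃'', y and χ. For fixed χ and y the admissible w form a subgroup `leftSlot K χ y`
containing [F₃'', F₃].

Two facts carry the proof. By `derivedSeries_two_le_of_basis`, a subgroup containing [F₃'', F₃] is
tested for containing F₃'' on the elements [[a, c], [b, c]] alone, (a, b, c) running over all bases:
modulo such a subgroup the commutator is a bilinear, conjugation-invariant pairing on F₃'/F₃'', and
changing the basis brings in all conjugates. By `mem_leftSlot_all`, these elements lie in every
slot: tame conjugation spreads the given twists over all bases with χ dual to a, and transvections
such as a ↦ ca, expanded bilinearly, give the remaining cases. -/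

namespace AutG3

open Subgroup
open scoped commutatorElement

/-! ### Bases of F₃ and elementary changes of basis -/

/-- `(a, b, c)` is a basis of the free group of rank three. -/
def IsBasis (a b c : F3) : Prop :=
  ∃ τ : MulAut F3, τ (FreeGroup.of 0) = a ∧ τ (FreeGroup.of 1) = b ∧ τ (FreeGroup.of 2) = c

/-- The automorphism `f₀ ↦ f₁ᵐ f₀ f₁ⁿ` of the free group, fixing `f₁` and `f₂`. -/
def transvection (m n : ℤ) : MulAut F3 :=
  MonoidHom.toMulEquiv
    (FreeGroup.lift ![FreeGroup.of 1 ^ m * FreeGroup.of 0 * FreeGroup.of 1 ^ n,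
      FreeGroup.of 1, FreeGroup.of 2])
    (FreeGroup.lift ![FreeGroup.of 1 ^ (-m) * FreeGroup.of 0 * FreeGroup.of 1 ^ (-n),
      FreeGroup.of 1, FreeGroup.of 2])
    (by ext i; fin_cases i <;> (simp; try group))
    (by ext i; fin_cases i <;> (simp; try group))

/-- The automorphism of the free group inverting all free generators. -/
def inversion : MulAut F3 :=
  MonoidHom.toMulEquiv (FreeGroup.lift fun i => (FreeGroup.of i)⁻¹)
    (FreeGroup.lift fun i => (FreeGroup.of i)⁻¹) (by ext i; simp) (by ext i; simp)

theorem inversion_of (i : Fin 3) : inversion (FreeGroup.of i) = (FreeGroup.of i)⁻¹ := by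
  simp [inversion]

theorem isBasis_of : IsBasis (FreeGroup.of 0) (FreeGroup.of 1) (FreeGroup.of 2) :=
  ⟨1, rfl, rfl, rfl⟩

theorem IsBasis.map {a b c : F3} (h : IsBasis a b c) (τ : MulAut F3) :
    IsBasis (τ a) (τ b) (τ c) := by
  obtain ⟨σ, rfl, rfl, rfl⟩ := h
  exact ⟨τ * σ, rfl, rfl, rfl⟩

theorem IsBasis.conj_mul {a b c : F3} (h : IsBasis a b c) (m n : ℤ) :
    IsBasis (b ^ m * a * b ^ n) b c := by
  obtain ⟨τ, rfl, rfl, rfl⟩ := h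
  exact ⟨τ * transvection m n, by simp [transvection], by simp [transvection],
    by simp [transvection]⟩

theorem IsBasis.swap {a b c : F3} (h : IsBasis a b c) : IsBasis b a c := by
  obtain ⟨τ, rfl, rfl, rfl⟩ := h
  refine ⟨τ * FreeGroup.freeGroupCongr (Equiv.swap 0 1), ?_, ?_, ?_⟩
  · simp
  · simp
  · rw [MulAut.mul_apply, FreeGroup.freeGroupCongr_apply, FreeGroup.map.of,
      Equiv.swap_apply_of_ne_of_ne (by decide) (by decide)]

theorem IsBasis.swap' {a b c : F3} (h : IsBasis a b c) : IsBasis a c b := by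
  obtain ⟨τ, rfl, rfl, rfl⟩ := h
  refine ⟨τ * FreeGroup.freeGroupCongr (Equiv.swap 1 2), ?_, ?_, ?_⟩
  · rw [MulAut.mul_apply, FreeGroup.freeGroupCongr_apply, FreeGroup.map.of,
      Equiv.swap_apply_of_ne_of_ne (by decide) (by decide)]
  · simp
  · simp

theorem IsBasis.inv {a b c : F3} (h : IsBasis a b c) : IsBasis a⁻¹ b⁻¹ c⁻¹ := by
  obtain ⟨τ, rfl, rfl, rfl⟩ := h
  exact ⟨τ * inversion, by simp [inversion_of], by simp [inversion_of], by simp [inversion_of]⟩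

theorem IsBasis.exists_monomial {a b c : F3} (h : IsBasis a b c) (g : F3) :
    ∃ i j k : ℤ, Abelianization.of g = Abelianization.of (a ^ i * b ^ j * c ^ k) := by
  obtain ⟨τ, rfl, rfl, rfl⟩ := h
  obtain ⟨g, rfl⟩ := τ.surjective g
  have key : ∀ s : Fin 3, ∃ i j k : ℤ, Abelianization.of (τ (FreeGroup.of s)) =
      Abelianization.of (τ (FreeGroup.of 0) ^ i * τ (FreeGroup.of 1) ^ j *
        τ (FreeGroup.of 2) ^ k) := by
    intro s
    fin_cases s
    · exact ⟨1, 0, 0, by simp⟩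
    · exact ⟨0, 1, 0, by simp⟩
    · exact ⟨0, 0, 1, by simp⟩
  induction g using FreeGroup.induction_on with
  | C1 => exact ⟨0, 0, 0, by simp⟩
  | of s => exact key s
  | inv_of s _ =>
    obtain ⟨i, j, k, e⟩ := key s
    refine ⟨-i, -j, -k, ?_⟩
    rw [map_inv, map_inv, e]
    simp [mul_comm]
  | mul x y hx hy =>
    obtain ⟨i, j, k, e⟩ := hx
    obtain ⟨i', j', k', e'⟩ := hy
    refine ⟨i + i', j + j', k + k', ?_⟩
    rw [map_mul, map_mul, e, e']
    simp only [map_mul, map_zpow, zpow_add]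
    rw [mul_mul_mul_comm, mul_mul_mul_comm (_ ^ i)]

/-! ### The commutator pairing on F' modulo a subgroup containing [F'', F] -/

section Pairing

variable {F : Type*} [Group F]

theorem commutator_mem_derivedSeries_two {u v : F} (hu : u ∈ commutator F)
    (hv : v ∈ commutator F) : ⁅u, v⁆ ∈ derivedSeries F 2 := by
  rw [derivedSeries_succ, derivedSeries_one]
  exact commutator_mem_commutator hu hv

theorem derivedSeries_two_le : derivedSeries F 2 ≤ commutator F := by
  rw [derivedSeries_succ, derivedSeries_one]
  exact commutator_le_left _ _

/-- Conjugation changes w ∈ F'' only by an element of [F'', F]; this is why S need not be normal and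
why the pairing is bilinear. -/
theorem conj_mem_of_mem {S : Subgroup F} (hS : ⁅derivedSeries F 2, (⊤ : Subgroup F)⁆ ≤ S)
    {w : F} (hw : w ∈ derivedSeries F 2) (g : F) (h : w ∈ S) : g * w * g⁻¹ ∈ S := by
  have h1 : ⁅w, g⁆⁻¹ ∈ S := S.inv_mem (hS (commutator_mem_commutator hw (mem_top g)))
  have : g * w * g⁻¹ = ⁅w, g⁆⁻¹ * w := by simp only [commutatorElement_def]; group
  rw [this]
  exact S.mul_mem h1 h

/-- The elements `u` of `F'` with `[u, v] ∈ S`. -/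
def annihilator (S : Subgroup F) (hS : ⁅derivedSeries F 2, (⊤ : Subgroup F)⁆ ≤ S)
    (v : F) (hv : v ∈ commutator F) : Subgroup F where
  carrier := {u | u ∈ commutator F ∧ ⁅u, v⁆ ∈ S}
  one_mem' := ⟨one_mem _, by simp⟩
  mul_mem' := by
    rintro a b ⟨ha, ha'⟩ ⟨hb, hb'⟩
    refine ⟨mul_mem ha hb, ?_⟩
    have : ⁅a * b, v⁆ = (a * ⁅b, v⁆ * a⁻¹) * ⁅a, v⁆ := by
      simp only [commutatorElement_def]; group
    rw [this]
    exact mul_mem (conj_mem_of_mem hS (commutator_mem_derivedSeries_two hb hv) a hb') ha'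
  inv_mem' := by
    rintro a ⟨ha, ha'⟩
    refine ⟨inv_mem ha, ?_⟩
    have : ⁅a⁻¹, v⁆ = a⁻¹ * ⁅a, v⁆⁻¹ * a⁻¹⁻¹ := by
      simp only [commutatorElement_def]; group
    rw [this]
    exact conj_mem_of_mem hS (inv_mem (commutator_mem_derivedSeries_two ha hv)) _ (inv_mem ha')

variable {S : Subgroup F} {hS : ⁅derivedSeries F 2, (⊤ : Subgroup F)⁆ ≤ S}

theorem derivedSeries_two_le_annihilator {v : F} {hv : v ∈ commutator F} :
    derivedSeries F 2 ≤ annihilator S hS v hv := fun _ hu =>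
  ⟨derivedSeries_two_le hu, hS (commutator_mem_commutator hu (mem_top v))⟩

theorem mem_annihilator_symm {u v : F} {hu : u ∈ commutator F} {hv : v ∈ commutator F}
    (h : u ∈ annihilator S hS v hv) : v ∈ annihilator S hS u hu :=
  ⟨hv, by rw [← commutatorElement_inv]; exact inv_mem h.2⟩

theorem mem_annihilator_inv {u v : F} {hv : v ∈ commutator F} {hv' : v⁻¹ ∈ commutator F}
    (h : u ∈ annihilator S hS v⁻¹ hv') : u ∈ annihilator S hS v hv := by
  have := inv_mem (mem_annihilator_symm (hu := h.1) h)
  rw [inv_inv] at this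
  exact mem_annihilator_symm this

theorem mem_annihilator_conj {u v : F} {hv : v ∈ commutator F} (g : F)
    {hv' : g * v * g⁻¹ ∈ commutator F}
    (h : u ∈ annihilator S hS v hv) : g * u * g⁻¹ ∈ annihilator S hS (g * v * g⁻¹) hv' := by
  refine ⟨Normal.conj_mem inferInstance _ h.1 g, ?_⟩
  rw [← conjugate_commutatorElement]
  exact conj_mem_of_mem hS (commutator_mem_derivedSeries_two h.1 hv) g h.2

/-- F'/F'' is a module over the group ring of F/F', so only the class of the conjugator in the
abelianization matters. Conjugators can thus be replaced by monomials in a basis. -/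
theorem conj_mem_annihilator_congr {u v : F} {hv : v ∈ commutator F} (hu : u ∈ commutator F)
    {g g' : F} (hg : Abelianization.of g = Abelianization.of g')
    (h : g * u * g⁻¹ ∈ annihilator S hS v hv) : g' * u * g'⁻¹ ∈ annihilator S hS v hv := by
  have h1 : g' * g⁻¹ ∈ commutator F := by
    rw [← Abelianization.ker_of, MonoidHom.mem_ker, map_mul, map_inv, hg, mul_inv_cancel]
  have h2 : ⁅g' * g⁻¹, g * u * g⁻¹⁆ ∈ annihilator S hS v hv :=
    derivedSeries_two_le_annihilator
      (commutator_mem_derivedSeries_two h1 (Normal.conj_mem inferInstance _ hu g))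
  have : g' * u * g'⁻¹ = ⁅g' * g⁻¹, g * u * g⁻¹⁆ * (g * u * g⁻¹) := by
    simp only [commutatorElement_def]; group
  rw [this]
  exact mul_mem h2 h

theorem commutatorElement_mem (a b : F) : ⁅a, b⁆ ∈ commutator F :=
  commutator_mem_commutator (mem_top a) (mem_top b)

end Pairing

/-! ### Generating F₃'' modulo [F₃'', F₃] from bases -/

section Generation

variable {S : Subgroup F3} (hS : VC ≤ S)

/-- All monomial conjugates `aⁱcᵏ[a, c]` annihilate `[b, c]`. -/
def MonomialConj (i : ℤ) : Prop :=
  ∀ a b c : F3, IsBasis a b c → ∀ k : ℤ,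
    (a ^ i * c ^ k) * ⁅a, c⁆ * (a ^ i * c ^ k)⁻¹ ∈
      annihilator S hS ⁅b, c⁆ (commutatorElement_mem b c)

variable {hS}

/-- A third exponent is gained by applying the hypothesis to the basis (bⁿab⁻ⁿ, b, c), whose first
member is congruent to a modulo F₃'. -/
theorem MonomialConj.all {i : ℤ} (H : MonomialConj hS i) {a b c : F3} (h : IsBasis a b c)
    (k n : ℤ) :
    (a ^ i * c ^ k * b ^ n) * ⁅a, b⁆ * (a ^ i * c ^ k * b ^ n)⁻¹ ∈
      annihilator S hS ⁅b, c⁆ (commutatorElement_mem b c) := by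
  set U := annihilator S hS ⁅b, c⁆ (commutatorElement_mem b c) with hU
  -- Since bⁿab⁻ⁿ = [bⁿ, a]a, expanding [[bⁿ, a]a, c] leaves, besides a conjugate of [a, c], the
  -- quotient of the conjugates of [bⁿ, a] with c-exponents k and k + 1.
  have step : ∀ k n : ℤ,
      (a ^ i * c ^ k) * ⁅b ^ n, a⁆ * (a ^ i * c ^ k)⁻¹ ∈ U ↔
        (a ^ i * c ^ (k + 1)) * ⁅b ^ n, a⁆ * (a ^ i * c ^ (k + 1))⁻¹ ∈ U := by
    intro k n
    have h2 := H _ _ _ (h.conj_mul n (-n)) k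
    rw [← hU] at h2
    have h3 := conj_mem_annihilator_congr (g' := a ^ i * c ^ k)
      (commutatorElement_mem _ _) (by simp [mul_comm]) h2
    have h4 := conj_mem_annihilator_congr (g' := a ^ i * c ^ k * ⁅b ^ n, a⁆)
      (commutatorElement_mem _ _) (by simp [commutatorElement_def]) (H _ _ _ h k)
    rw [← hU] at h3 h4
    have e : (a ^ i * c ^ k) * ⁅b ^ n * a * b ^ (-n), c⁆ * (a ^ i * c ^ k)⁻¹ =
        ((a ^ i * c ^ k * ⁅b ^ n, a⁆) * ⁅a, c⁆ * (a ^ i * c ^ k * ⁅b ^ n, a⁆)⁻¹) *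
        (((a ^ i * c ^ k) * ⁅b ^ n, a⁆ * (a ^ i * c ^ k)⁻¹) *
        ((a ^ i * c ^ (k + 1)) * ⁅b ^ n, a⁆ * (a ^ i * c ^ (k + 1))⁻¹)⁻¹) := by
      simp only [commutatorElement_def]; group
    rw [e, mul_mem_cancel_left h4] at h3
    constructor
    · intro h5
      rw [mul_mem_cancel_left h5] at h3
      exact inv_mem_iff.mp h3
    · intro h5
      rwa [mul_mem_cancel_right (inv_mem h5)] at h3
  have succ : ∀ g : F3, ∀ n : ℤ, g * ⁅b ^ (n + 1), a⁆ * g⁻¹ =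
      ((g * b ^ n) * ⁅b, a⁆ * (g * b ^ n)⁻¹) * (g * ⁅b ^ n, a⁆ * g⁻¹) := by
    intro g n
    simp only [commutatorElement_def]; group
  -- For c-exponent 0, use the basis (a, c, b) and build [bⁿ, a] from conjugates of [b, a] by powers
  -- of b.
  have base : ∀ n : ℤ, (a ^ i) * ⁅b ^ n, a⁆ * (a ^ i)⁻¹ ∈ U := by
    have h1 : ∀ n : ℤ, (a ^ i * b ^ n) * ⁅b, a⁆ * (a ^ i * b ^ n)⁻¹ ∈ U := by
      intro n
      have h2 := H _ _ _ h.swap' n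
      have h3 := mem_annihilator_inv (v := ⁅b, c⁆) (hv := commutatorElement_mem b c)
        (hv' := inv_mem (commutatorElement_mem b c)) (by simpa only [commutatorElement_inv] using h2)
      have h4 := inv_mem h3
      rw [hU]
      convert h4 using 1
      simp only [commutatorElement_def]; group
    intro n
    induction n using Int.induction_on with
    | zero => simp
    | succ n hn => rw [succ]; exact mul_mem (h1 _) hn
    | pred n hn =>
      have := succ (a ^ i) (-(n : ℤ) - 1)
      rw [sub_add_cancel] at this
      rwa [this, mul_mem_cancel_left (h1 _)] at hn
  have shifted : ∀ k n : ℤ, (a ^ i * c ^ k) * ⁅b ^ n, a⁆ * (a ^ i * c ^ k)⁻¹ ∈ U := by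
    intro k n
    induction k using Int.induction_on with
    | zero => simpa using base n
    | succ k hk => exact (step _ _).mp hk
    | pred k hk => exact (step _ _).mpr (by rwa [sub_add_cancel])
  -- Comparing [bⁿ⁺¹, a] with [bⁿ, a] isolates a single conjugate of [b, a].
  have h1 := shifted k (n + 1)
  rw [succ, mul_mem_cancel_right (shifted k n)] at h1
  convert inv_mem h1 using 1
  simp only [commutatorElement_def]; group

/-- If `S` contains `[[a, c], [b, c]]` for all bases, then it contains `[ᵍ[a, c], [b, c]]`. -/
theorem conj_mem_annihilator_of_basis
    (H : ∀ a b c : F3, IsBasis a b c → ⁅⁅a, c⁆, ⁅b, c⁆⁆ ∈ S)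
    {a b c : F3} (h : IsBasis a b c) (g : F3) :
    g * ⁅a, c⁆ * g⁻¹ ∈ annihilator S hS ⁅b, c⁆ (commutatorElement_mem b c) := by
  -- The basis (cᵏac⁻ᵏ, b, c) turns [a, c] into its conjugate by cᵏ.
  have h0 : MonomialConj hS 0 := by
    intro a b c h k
    have := H _ _ _ (h.swap'.conj_mul k (-k)).swap'
    refine ⟨Normal.conj_mem inferInstance _ (commutatorElement_mem a c) _, ?_⟩
    convert this using 2
    simp only [commutatorElement_def]; group
  -- The case i = 0 on the basis (b, c, a) puts the conjugator p on [b, c]; symmetry and invariance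
  -- under p⁻¹ move it to [c, a], and p⁻¹ is congruent to aⁱcᵏ modulo F₃'.
  have h1 : ∀ i, MonomialConj hS i := by
    intro i a b c h k
    have h2 := h0.all h.swap.swap' (-i) (-k)
    set p := b ^ (0 : ℤ) * a ^ (-i) * c ^ (-k) with hp
    have h3 := mem_annihilator_conj
      (hv' := Normal.conj_mem inferInstance _ (Normal.conj_mem inferInstance _
        (commutatorElement_mem b c) p) p⁻¹) p⁻¹
      (mem_annihilator_symm (hu := Normal.conj_mem inferInstance _
        (commutatorElement_mem b c) p) h2)
    have h4 : p⁻¹ * ⁅c, a⁆ * p⁻¹⁻¹ ∈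
        annihilator S hS ⁅b, c⁆ (commutatorElement_mem b c) := by
      refine ⟨h3.1, ?_⟩
      have h5 := h3.2
      have e : p⁻¹ * (p * ⁅b, c⁆ * p⁻¹) * p⁻¹⁻¹ = ⁅b, c⁆ := by group
      rwa [e] at h5
    have h5 := inv_mem (conj_mem_annihilator_congr (g' := a ^ i * c ^ k)
      (commutatorElement_mem _ _) (by simp [hp, mul_comm]) h4)
    convert h5 using 1
    simp only [commutatorElement_def]; group
  obtain ⟨i, j, k, e⟩ := h.exists_monomial g
  have h2 := (h1 i).all h.swap' j k
  have h3 := mem_annihilator_inv (v := ⁅b, c⁆) (hv := commutatorElement_mem b c)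
        (hv' := inv_mem (commutatorElement_mem b c)) (by simpa only [commutatorElement_inv] using h2)
  exact conj_mem_annihilator_congr (commutatorElement_mem _ _) e.symm h3

/-- Compare the bases (ba, b, c) and (a, b, c): [ba, c] is a conjugate of [a, c] times [b, c]. -/
theorem conj_mem_annihilator_self
    (H : ∀ a b c : F3, IsBasis a b c → ⁅⁅a, c⁆, ⁅b, c⁆⁆ ∈ S)
    {a b c : F3} (h : IsBasis a b c) (g : F3) :
    g * ⁅b, c⁆ * g⁻¹ ∈ annihilator S hS ⁅b, c⁆ (commutatorElement_mem b c) := by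
  have h1 := conj_mem_annihilator_of_basis (hS := hS) H (h.conj_mul 1 0) g
  have h2 := conj_mem_annihilator_of_basis (hS := hS) H h (g * b)
  have e : g * ⁅b ^ (1 : ℤ) * a * b ^ (0 : ℤ), c⁆ * g⁻¹ =
      ((g * b) * ⁅a, c⁆ * (g * b)⁻¹) * (g * ⁅b, c⁆ * g⁻¹) := by
    simp only [commutatorElement_def]; group
  rwa [e, mul_mem_cancel_left h2] at h1

/-- Conjugates of the commutators of the free generators generate `F₃'`. -/
theorem commutator_le_of_conj {U : Subgroup F3} {a b c : F3} (h : IsBasis a b c)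
    (h1 : ∀ g, g * ⁅a, b⁆ * g⁻¹ ∈ U) (h2 : ∀ g, g * ⁅a, c⁆ * g⁻¹ ∈ U)
    (h3 : ∀ g, g * ⁅b, c⁆ * g⁻¹ ∈ U) : commutator F3 ≤ U := by
  obtain ⟨τ, rfl, rfl, rfl⟩ := h
  set N := normalClosure {z : F3 | ∃ i j : Fin 3,
    z = ⁅τ (FreeGroup.of i), τ (FreeGroup.of j)⁆} with hN
  have hc : commutator F3 ≤ N := by
    rw [commutator_def, commutator_le]
    -- Modulo N the basis elements commute pairwise; this extends to all elements one argument at a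
    -- time.
    have key : ∀ u v : F3, ⁅τ u, τ v⁆ ∈ N := by
      have trans_left : ∀ v : F3, (∀ i, ⁅τ (FreeGroup.of i), τ v⁆ ∈ N) →
          ∀ u, ⁅τ u, τ v⁆ ∈ N := by
        intro v hv u
        rw [← QuotientGroup.eq_one_iff]
        simp only [← QuotientGroup.eq_one_iff] at hv
        have e : ∀ x : F3, (((⁅τ x, τ v⁆ : F3) : F3 ⧸ N)) =
            ⁅((τ x : F3) : F3 ⧸ N), ((τ v : F3) : F3 ⧸ N)⁆ := fun x => rfl
        simp only [e, commutatorElement_eq_one_iff_commute] at hv ⊢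
        induction u using FreeGroup.induction_on with
        | C1 => simp
        | of s => exact hv s
        | inv_of s _ => simpa using hv s
        | mul x y hx hy => rw [map_mul, QuotientGroup.mk_mul]; exact hx.mul_left hy
      have symm : ∀ u v : F3, ⁅τ u, τ v⁆ ∈ N → ⁅τ v, τ u⁆ ∈ N := fun u v huv => by
        rw [← commutatorElement_inv]; exact inv_mem huv
      intro u v
      refine trans_left v (fun i => symm _ _ (trans_left _ (fun j => ?_) v)) u
      exact subset_normalClosure ⟨j, i, rfl⟩
    intro u _ v _
    obtain ⟨u, rfl⟩ := τ.surjective u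
    obtain ⟨v, rfl⟩ := τ.surjective v
    exact key u v
  refine hc.trans ?_
  rw [hN, normalClosure, closure_le]
  intro z hz
  obtain ⟨w, ⟨i, j, rfl⟩, hz⟩ := Group.mem_conjugatesOfSet_iff.mp hz
  obtain ⟨g, rfl⟩ := isConj_iff.mp hz
  have inv : ∀ u v : F3, (∀ g, g * ⁅u, v⁆ * g⁻¹ ∈ U) → g * ⁅v, u⁆ * g⁻¹ ∈ U := by
    intro u v huv
    convert inv_mem (huv g) using 1
    simp only [commutatorElement_def]; group
  fin_cases i <;> fin_cases j
  · simp
  · exact h1 g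
  · exact h2 g
  · exact inv _ _ h1
  · simp
  · exact h3 g
  · exact inv _ _ h2
  · exact inv _ _ h3
  · simp

/-- A subgroup containing `[F₃'', F₃]` and all `[[a, c], [b, c]]` for bases `(a, b, c)`
contains `F₃''`. -/
theorem derivedSeries_two_le_of_basis (hS : VC ≤ S)
    (H : ∀ a b c : F3, IsBasis a b c → ⁅⁅a, c⁆, ⁅b, c⁆⁆ ∈ S) : derivedSeries F3 2 ≤ S := by
  have key : ∀ a b c : F3, IsBasis a b c → ∀ u ∈ commutator F3, ⁅⁅b, c⁆, u⁆ ∈ S := by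
    intro a b c h u hu
    have hle : commutator F3 ≤ annihilator S hS ⁅b, c⁆ (commutatorElement_mem b c) := by
      refine commutator_le_of_conj h (fun g => ?_)
        (fun g => conj_mem_annihilator_of_basis H h g)
        (fun g => conj_mem_annihilator_self H h g)
      exact mem_annihilator_inv (hv' := inv_mem (commutatorElement_mem b c))
        (by simpa only [commutatorElement_inv] using
          conj_mem_annihilator_of_basis (hS := hS) H h.swap' g)
    rw [← commutatorElement_inv]
    exact inv_mem (hle hu).2
  -- By invariance, a conjugator on [b, c] is absorbed into the arbitrary element u.
  have key' : ∀ a b c : F3, IsBasis a b c → ∀ u (hu : u ∈ commutator F3), ∀ g,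
      g * ⁅b, c⁆ * g⁻¹ ∈ annihilator S hS u hu := by
    intro a b c h u hu g
    refine ⟨Normal.conj_mem inferInstance _ (commutatorElement_mem b c) _, ?_⟩
    have h1 := key a b c h (g⁻¹ * u * g⁻¹⁻¹) (Normal.conj_mem inferInstance _ hu _)
    have h2 := conj_mem_of_mem hS (commutator_mem_derivedSeries_two (commutatorElement_mem b c)
      (Normal.conj_mem inferInstance _ hu _)) g h1
    convert h2 using 1
    simp only [commutatorElement_def]; group
  rw [derivedSeries_succ, derivedSeries_one, commutator_le]
  intro u hu v hv
  refine (?_ : commutator F3 ≤ annihilator S hS v hv) hu |>.2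
  exact commutator_le_of_conj isBasis_of (key' _ _ _ isBasis_of.swap'.swap v hv)
    (key' _ _ _ isBasis_of.swap v hv) (key' _ _ _ isBasis_of v hv)

end Generation

/-! ### Tame automorphisms and central twists of G₃ -/

theorem conjClosure_conj {G : Type*} [Group G] {X : Set G} {K : Subgroup G} {y k : G}
    (hy : y ∈ K) (hk : k ∈ conjClosure X K) : y⁻¹ * k * y ∈ conjClosure X K := by
  induction hk using closure_induction with
  | mem z hz =>
    obtain ⟨w, hw, x, hx, rfl⟩ := hz
    exact subset_closure ⟨w * y, mul_mem hw hy, x, hx, by group⟩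
  | one => simp
  | mul a b _ _ ha hb =>
    have : y⁻¹ * (a * b) * y = (y⁻¹ * a * y) * (y⁻¹ * b * y) := by group
    rw [this]; exact mul_mem ha hb
  | inv a _ ha =>
    have : y⁻¹ * a⁻¹ * y = (y⁻¹ * a * y)⁻¹ := by group
    rw [this]; exact inv_mem ha

/-- The tame automorphism of `G₃` induced by an automorphism of `F₃`. -/
noncomputable def tame : MulAut F3 →* MulAut G3 :=
  inducedAut (QuotientGroup.mk' VG) (QuotientGroup.mk'_surjective VG) mkG_ker_characteristic

theorem tame_mk (τ : MulAut F3) (f : F3) :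
    tame τ (QuotientGroup.mk' VG f) = QuotientGroup.mk' VG (τ f) :=
  inducedAut_apply _ _ _ _ _

theorem mk_eq_one {f : F3} : QuotientGroup.mk' VG f = 1 ↔ f ∈ VG :=
  QuotientGroup.eq_one_iff f

theorem mk_commute_of_mem {z : F3} (hz : z ∈ VC) (f : F3) :
    Commute (QuotientGroup.mk' VG z) (QuotientGroup.mk' VG f) := by
  rw [← commutatorElement_eq_one_iff_commute, ← map_commutatorElement, mk_eq_one]
  exact commutator_mem_commutator hz (mem_top f)

theorem VC_le_commutator : VC ≤ commutator F3 :=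
  commutator_mono le_top le_top

theorem eq_one_of_mem_commutator (χ : F3 →* Multiplicative ℤ) {z : F3}
    (hz : z ∈ commutator F3) : χ z = 1 :=
  Abelianization.commutator_subset_ker χ hz

theorem map_VC (τ : MulAut F3) {z : F3} (hz : z ∈ VC) : τ z ∈ VC := by
  have h : VC.Characteristic := inferInstance
  rw [← characteristic_iff_map_eq.mp h τ]
  exact mem_map_of_mem _ hz

/-- `κ` multiplies every `f` by `z` to the power `χ(f)`. -/
def IsTwist (κ : MulAut G3) (χ : F3 →* Multiplicative ℤ) (z : F3) : Prop :=
  ∀ f, κ (QuotientGroup.mk' VG f) =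
    QuotientGroup.mk' VG f * QuotientGroup.mk' VG z ^ (χ f).toAdd

/-- The endomorphism of `G₃` multiplying every `f` by `z` to the power `χ(f)`. -/
def twistHom (χ : F3 →* Multiplicative ℤ) {z : F3} (hz : z ∈ VC) : G3 →* G3 :=
  QuotientGroup.lift VG
    { toFun := fun f => QuotientGroup.mk' VG f * QuotientGroup.mk' VG z ^ (χ f).toAdd
      map_one' := by simp
      map_mul' := fun f g => by
        have h := (mk_commute_of_mem hz g).zpow_left (χ f).toAdd
        simp only [map_mul, toAdd_mul, zpow_add]
        simp only [mul_assoc]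
        rw [← mul_assoc (QuotientGroup.mk' VG g), ← h.eq, mul_assoc] }
    (fun f hf => by
      have h1 : χ f = 1 := eq_one_of_mem_commutator χ (VC_le_commutator (VG_le_VC hf))
      have h2 : QuotientGroup.mk' VG f = 1 := mk_eq_one.mpr hf
      simp only [MonoidHom.mem_ker, MonoidHom.coe_mk, OneHom.coe_mk, h1, h2]
      simp)

theorem twistHom_mk (χ : F3 →* Multiplicative ℤ) {z : F3} (hz : z ∈ VC) (f : F3) :
    twistHom χ hz (QuotientGroup.mk' VG f) =
      QuotientGroup.mk' VG f * QuotientGroup.mk' VG z ^ (χ f).toAdd := rfl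

theorem twistHom_comp (χ : F3 →* Multiplicative ℤ) {z z' : F3} (hz : z ∈ VC) (hz' : z' ∈ VC)
    (h : z * z' = 1) : (twistHom χ hz).comp (twistHom χ hz') = MonoidHom.id G3 := by
  refine MonoidHom.ext fun g => ?_
  obtain ⟨f, rfl⟩ := QuotientGroup.mk'_surjective VG g
  have h1 := eq_one_of_mem_commutator χ (VC_le_commutator hz')
  obtain rfl := eq_inv_of_mul_eq_one_right h
  rw [MonoidHom.comp_apply, twistHom_mk, map_mul, map_zpow, twistHom_mk, twistHom_mk, h1]
  simp

theorem exists_isTwist (χ : F3 →* Multiplicative ℤ) {z : F3} (hz : z ∈ VC) :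
    ∃ κ : MulAut G3, IsTwist κ χ z :=
  ⟨MonoidHom.toMulEquiv (twistHom χ hz) (twistHom χ (inv_mem hz))
    (twistHom_comp χ _ _ (by simp)) (twistHom_comp χ _ _ (by simp)), fun _ => rfl⟩

/-- Characters vanish on F₃', hence on [F₃'', F₃]; composing twists therefore produces no cross
terms. -/
theorem IsTwist.mk_of_mem {κ : MulAut G3} {χ : F3 →* Multiplicative ℤ} {z w : F3}
    (h : IsTwist κ χ z) (hw : w ∈ VC) :
    κ (QuotientGroup.mk' VG w) = QuotientGroup.mk' VG w := by
  rw [h, eq_one_of_mem_commutator χ (VC_le_commutator hw)]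
  simp

section Twisted

variable (K : Subgroup (MulAut G3))

/-- `K` contains the automorphism multiplying every `f` by `z` to the power `χ(f)`. -/
def Twisted (χ : F3 →* Multiplicative ℤ) (z : F3) : Prop :=
  z ∈ VC ∧ ∃ κ ∈ K, IsTwist κ χ z

variable {K} {χ χ' : F3 →* Multiplicative ℤ} {z z' : F3}

theorem Twisted.congr (h : Twisted K χ z)
    (e : QuotientGroup.mk' VG z = QuotientGroup.mk' VG z') : Twisted K χ z' := by
  obtain ⟨hz, κ, hκ, hf⟩ := h
  refine ⟨?_, κ, hκ, fun f => by rw [← e]; exact hf f⟩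
  have h1 : z⁻¹ * z' ∈ VG := QuotientGroup.eq.mp e
  simpa using mul_mem hz (VG_le_VC h1)

theorem twisted_of_mem_VG (h : z ∈ VG) : Twisted K χ z :=
  ⟨VG_le_VC h, 1, one_mem K, fun f => by simp [mk_eq_one.mpr h]⟩

theorem Twisted.mul (h : Twisted K χ z) (h' : Twisted K χ z') : Twisted K χ (z * z') := by
  obtain ⟨hz, κ, hκ, hf⟩ := h
  obtain ⟨hz', κ', hκ', hf'⟩ := h'
  refine ⟨mul_mem hz hz', κ * κ', mul_mem hκ hκ', fun f => ?_⟩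
  rw [MulAut.mul_apply, hf', map_mul, map_zpow, hf, hf.mk_of_mem hz', map_mul,
    (mk_commute_of_mem hz z').mul_zpow, mul_assoc]

theorem Twisted.inv (h : Twisted K χ z) : Twisted K χ z⁻¹ := by
  obtain ⟨hz, κ, hκ, hf⟩ := h
  refine ⟨inv_mem hz, κ⁻¹, inv_mem hκ, fun f => ?_⟩
  apply κ.injective
  rw [MulAut.apply_inv_self, map_mul, map_zpow, map_inv, map_inv, hf.mk_of_mem hz, hf]
  simp

theorem Twisted.mul_char (h : Twisted K χ z) (h' : Twisted K χ' z) : Twisted K (χ * χ') z := by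
  obtain ⟨hz, κ, hκ, hf⟩ := h
  obtain ⟨hz', κ', hκ', hf'⟩ := h'
  refine ⟨hz, κ * κ', mul_mem hκ hκ', fun f => ?_⟩
  rw [MulAut.mul_apply, hf', map_mul, map_zpow, hf, hf.mk_of_mem hz', MonoidHom.mul_apply,
    toAdd_mul, zpow_add, mul_assoc]

theorem Twisted.inv_char (h : Twisted K χ z) : Twisted K χ⁻¹ z := by
  obtain ⟨hz, κ, hκ, hf⟩ := h.inv
  refine ⟨by simpa using inv_mem hz, κ, hκ, fun f => ?_⟩
  rw [hf]
  simp

theorem twisted_one : Twisted K 1 z ↔ z ∈ VC :=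
  ⟨fun h => h.1, fun h => ⟨h, 1, one_mem K, fun f => by simp⟩⟩

/-- Conjugating a twist by a tame automorphism transports z by τ and χ by τ⁻¹, so duality between χ
and a basis is preserved. -/
theorem Twisted.map (hK : ∀ τ, ∀ κ ∈ K, (tame τ)⁻¹ * κ * tame τ ∈ K) (h : Twisted K χ z)
    (τ : MulAut F3) : Twisted K (χ.comp τ⁻¹.toMonoidHom) (τ z) := by
  obtain ⟨hz, κ, hκ, hf⟩ := h
  refine ⟨map_VC τ hz, _, hK τ⁻¹ κ hκ, fun f => ?_⟩
  rw [map_inv, inv_inv, MulAut.mul_apply, MulAut.mul_apply, ← map_inv, tame_mk, hf, map_mul,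
    map_zpow, tame_mk, tame_mk, MulAut.apply_inv_self]
  rfl

end Twisted

/-! ### Bilinearity of [w, y] in G₃ for w in F₃'' -/

section CentralPairing

variable {w w' : F3}

theorem commutatorElement_mem_VC (hw : w ∈ derivedSeries F3 2) (y : F3) : ⁅w, y⁆ ∈ VC :=
  commutator_mem_commutator hw (mem_top y)

theorem mk_conj_of_mem {z : F3} (hz : z ∈ VC) (g : F3) :
    QuotientGroup.mk' VG (g * z * g⁻¹) = QuotientGroup.mk' VG z := by
  rw [map_mul, map_mul, ← (mk_commute_of_mem hz g).eq, map_inv, mul_inv_cancel_right]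

theorem mk_commutatorElement_mul_right (hw : w ∈ derivedSeries F3 2) (y y' : F3) :
    QuotientGroup.mk' VG ⁅w, y * y'⁆ = QuotientGroup.mk' VG (⁅w, y⁆ * ⁅w, y'⁆) := by
  have : ⁅w, y * y'⁆ = ⁅w, y⁆ * (y * ⁅w, y'⁆ * y⁻¹) := by
    simp only [commutatorElement_def]; group
  rw [this, map_mul, mk_conj_of_mem (commutatorElement_mem_VC hw y'), map_mul]

theorem mk_commutatorElement_inv_right (hw : w ∈ derivedSeries F3 2) (y : F3) :
    QuotientGroup.mk' VG ⁅w, y⁻¹⁆ = QuotientGroup.mk' VG ⁅w, y⁆⁻¹ := by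
  have h := mk_commutatorElement_mul_right hw y y⁻¹
  rw [mul_inv_cancel, commutatorElement_one_right, map_one, map_mul] at h
  rw [map_inv]
  exact eq_inv_of_mul_eq_one_right h.symm

theorem mk_commutatorElement_mul_left (hw' : w' ∈ derivedSeries F3 2)
    (y : F3) :
    QuotientGroup.mk' VG ⁅w * w', y⁆ = QuotientGroup.mk' VG (⁅w', y⁆ * ⁅w, y⁆) := by
  have : ⁅w * w', y⁆ = (w * ⁅w', y⁆ * w⁻¹) * ⁅w, y⁆ := by
    simp only [commutatorElement_def]; group
  rw [this, map_mul, mk_conj_of_mem (commutatorElement_mem_VC hw' y), map_mul]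

theorem mk_commutatorElement_inv_left (hw : w ∈ derivedSeries F3 2) (y : F3) :
    QuotientGroup.mk' VG ⁅w⁻¹, y⁆ = QuotientGroup.mk' VG ⁅w, y⁆⁻¹ := by
  have h := mk_commutatorElement_mul_left (w := w) (inv_mem hw) y
  rw [mul_inv_cancel, commutatorElement_one_left, map_one, map_mul] at h
  rw [map_inv]
  exact eq_inv_of_mul_eq_one_left h.symm

end CentralPairing

/-! ### Slots: the twists by [w, y] contained in K -/

section Slots

variable (K : Subgroup (MulAut G3))

/-- The elements `w` of `F₃''` such that `K` contains the twist by `[w, y]` along `χ`. -/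
def leftSlot (χ : F3 →* Multiplicative ℤ) (y : F3) : Subgroup F3 where
  carrier := {w | w ∈ derivedSeries F3 2 ∧ Twisted K χ ⁅w, y⁆}
  one_mem' := ⟨one_mem _, twisted_of_mem_VG (by simp)⟩
  mul_mem' := fun ha hb => ⟨mul_mem ha.1 hb.1,
    (hb.2.mul ha.2).congr (mk_commutatorElement_mul_left hb.1 y).symm⟩
  inv_mem' := fun ha => ⟨inv_mem ha.1, ha.2.inv.congr (mk_commutatorElement_inv_left ha.1 y).symm⟩

variable {K} {χ χ' : F3 →* Multiplicative ℤ} {w y y' : F3}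

/-- This makes a slot an admissible S for the pairing and generation arguments. -/
theorem VC_le_leftSlot : VC ≤ leftSlot K χ y := fun _ hw =>
  ⟨commutator_le_left _ _ hw,
    twisted_of_mem_VG (commutator_mem_commutator hw (mem_top y))⟩

theorem mem_leftSlot_mul (h : w ∈ leftSlot K χ y) (h' : w ∈ leftSlot K χ y') :
    w ∈ leftSlot K χ (y * y') :=
  ⟨h.1, (h.2.mul h'.2).congr (mk_commutatorElement_mul_right h.1 y y').symm⟩

theorem mem_leftSlot_inv (h : w ∈ leftSlot K χ y) : w ∈ leftSlot K χ y⁻¹ :=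
  ⟨h.1, h.2.inv.congr (mk_commutatorElement_inv_right h.1 y).symm⟩

theorem mem_leftSlot_of_basis {a b c : F3} (hb : IsBasis a b c) (h1 : w ∈ leftSlot K χ a)
    (h2 : w ∈ leftSlot K χ b) (h3 : w ∈ leftSlot K χ c) (y : F3) : w ∈ leftSlot K χ y := by
  obtain ⟨τ, rfl, rfl, rfl⟩ := hb
  obtain ⟨y, rfl⟩ := τ.surjective y
  induction y using FreeGroup.induction_on with
  | C1 => exact ⟨h1.1, twisted_of_mem_VG (by simp)⟩
  | of s => fin_cases s <;> assumption
  | inv_of s h => rw [map_inv]; exact mem_leftSlot_inv h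
  | mul x y hx hy => rw [map_mul]; exact mem_leftSlot_mul hx hy

/-- `χ` is the dual basis vector of `a` with respect to `(a, b, c)`. -/
def IsDual (χ : F3 →* Multiplicative ℤ) (a b c : F3) : Prop :=
  χ a = Multiplicative.ofAdd 1 ∧ χ b = 1 ∧ χ c = 1

theorem IsDual.swap {a b c : F3} (h : IsDual χ a b c) : IsDual χ a c b := ⟨h.1, h.2.2, h.2.1⟩

/-- The character sending `fᵢ` to `1` and the other free generators to `0`. -/
def coord (i : Fin 3) : F3 →* Multiplicative ℤ :=
  FreeGroup.lift (Pi.mulSingle i (Multiplicative.ofAdd 1))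

theorem coord_self (i : Fin 3) : coord i (FreeGroup.of i) = Multiplicative.ofAdd 1 := by
  simp [coord]

theorem coord_ne {i j : Fin 3} (h : j ≠ i) : coord i (FreeGroup.of j) = 1 := by
  simp [coord, h]

theorem IsBasis.hom_ext {M : Type*} [Monoid M] {a b c : F3} (h : IsBasis a b c) {χ χ' : F3 →* M}
    (h1 : χ a = χ' a) (h2 : χ b = χ' b) (h3 : χ c = χ' c) : χ = χ' := by
  obtain ⟨τ, rfl, rfl, rfl⟩ := h
  have : χ.comp τ.toMonoidHom = χ'.comp τ.toMonoidHom := by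
    ext i
    fin_cases i <;> assumption
  refine MonoidHom.ext fun f => ?_
  obtain ⟨f, rfl⟩ := τ.surjective f
  exact DFunLike.congr_fun this f

theorem IsBasis.exists_dual {a b c : F3} (h : IsBasis a b c) : ∃ χ, IsDual χ a b c := by
  obtain ⟨τ, rfl, rfl, rfl⟩ := h
  refine ⟨(coord 0).comp τ⁻¹.toMonoidHom, ?_⟩
  have e : ∀ f, ((coord 0).comp τ⁻¹.toMonoidHom) (τ f) = coord 0 f := fun f =>
    congrArg (coord 0) (MulAut.inv_apply_self _ τ f)
  exact ⟨(e _).trans (coord_self 0), (e _).trans (coord_ne (by decide)),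
    (e _).trans (coord_ne (by decide))⟩

theorem mem_leftSlot_mul_char (h : w ∈ leftSlot K χ y) (h' : w ∈ leftSlot K χ' y) :
    w ∈ leftSlot K (χ * χ') y := ⟨h.1, h.2.mul_char h'.2⟩

theorem mem_leftSlot_inv_char (h : w ∈ leftSlot K χ y) : w ∈ leftSlot K χ⁻¹ y :=
  ⟨h.1, h.2.inv_char⟩

theorem mem_leftSlot_zpow_char (h : w ∈ leftSlot K χ y) (n : ℤ) : w ∈ leftSlot K (χ ^ n) y := by
  induction n using Int.induction_on with
  | zero =>
    rw [zpow_zero]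
    exact ⟨h.1, twisted_one.mpr (commutatorElement_mem_VC h.1 y)⟩
  | succ n hn => rw [zpow_add_one]; exact mem_leftSlot_mul_char hn h
  | pred n hn => rw [zpow_sub_one]; exact mem_leftSlot_mul_char hn (mem_leftSlot_inv_char h)

theorem mem_leftSlot_of_dual {a b c : F3} (hb : IsBasis a b c)
    (h1 : ∀ χ, IsDual χ a b c → w ∈ leftSlot K χ y)
    (h2 : ∀ χ, IsDual χ b a c → w ∈ leftSlot K χ y)
    (h3 : ∀ χ, IsDual χ c a b → w ∈ leftSlot K χ y) (χ : F3 →* Multiplicative ℤ) :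
    w ∈ leftSlot K χ y := by
  obtain ⟨χ₁, d1⟩ := hb.exists_dual
  obtain ⟨χ₂, d2⟩ := hb.swap.exists_dual
  obtain ⟨χ₃, d3⟩ := hb.swap'.swap.exists_dual
  have : χ = χ₁ ^ (χ a).toAdd * χ₂ ^ (χ b).toAdd * χ₃ ^ (χ c).toAdd := by
    refine hb.hom_ext ?_ ?_ ?_
    · simp [d1.1, d2.2.1, d3.2.1, ← ofAdd_zsmul]
    · simp [d1.2.1, d2.1, d3.2.2, ← ofAdd_zsmul]
    · simp [d1.2.2, d2.2.2, d3.1, ← ofAdd_zsmul]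
  rw [this]
  exact mem_leftSlot_mul_char (mem_leftSlot_mul_char (mem_leftSlot_zpow_char (h1 _ d1) _)
    (mem_leftSlot_zpow_char (h2 _ d2) _)) (mem_leftSlot_zpow_char (h3 _ d3) _)

/-- Here [ca, b] is the c-conjugate of [a, b] times [c, b], and [ca, c] is the c-conjugate of [a,
c]. By invariance the first factor pairs trivially with [ca, c], so only the [c, b] term survives.
-/
theorem commutatorElement_mem_of_transvection {S : Subgroup F3} (hS : VC ≤ S) {a b c : F3}
    (h : ⁅⁅a, b⁆, ⁅a, c⁆⁆ ∈ S) (h' : ⁅⁅c * a, b⁆, ⁅c * a, c⁆⁆ ∈ S) :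
    ⁅⁅c, b⁆, ⁅c * a * c⁻¹, c⁆⁆ ∈ S := by
  have e1 : ⁅c * a, c⁆ = ⁅c * a * c⁻¹, c⁆ := by simp only [commutatorElement_def]; group
  have e2 : c * ⁅a, c⁆ * c⁻¹ = ⁅c * a * c⁻¹, c⁆ := by simp only [commutatorElement_def]; group
  have e3 : ⁅c * a, b⁆ = (c * ⁅a, b⁆ * c⁻¹) * ⁅c, b⁆ := by
    simp only [commutatorElement_def]; group
  rw [e1] at h'
  have h1 : ⁅a, b⁆ ∈ annihilator S hS ⁅a, c⁆ (commutatorElement_mem a c) :=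
    ⟨commutatorElement_mem _ _, h⟩
  have h2 : c * ⁅a, b⁆ * c⁻¹ ∈ annihilator S hS ⁅c * a * c⁻¹, c⁆ (commutatorElement_mem _ _) :=
    ⟨Normal.conj_mem inferInstance _ h1.1 c, by
      rw [← e2]
      exact (mem_annihilator_conj (hv' := Normal.conj_mem inferInstance _
        (commutatorElement_mem a c) c) c h1).2⟩
  have h3 : ⁅c * a, b⁆ ∈ annihilator S hS ⁅c * a * c⁻¹, c⁆ (commutatorElement_mem _ _) :=
    ⟨commutatorElement_mem _ _, h'⟩
  rw [e3, mul_mem_cancel_left h2] at h3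
  exact h3.2

theorem IsBasis.conj {a b c : F3} (h : IsBasis a b c) : IsBasis (c⁻¹ * a * c) b c := by
  simpa using (h.swap'.conj_mul (-1) 1).swap'

theorem IsDual.conj {a b c : F3} (h : IsDual χ a b c) : IsDual χ (c⁻¹ * a * c) b c :=
  ⟨by simp [h.1, h.2.2], h.2⟩

theorem IsBasis.mul_right {a b c : F3} (h : IsBasis a b c) : IsBasis (a * c) b c := by
  simpa using (h.swap'.conj_mul 0 1).swap'

theorem IsDual.mul_right {a b c : F3} (h : IsDual χ a b c) : IsDual χ (a * c) b c :=
  ⟨by simp [h.1, h.2.2], h.2⟩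

variable (H₁ : ∀ a b c χ, IsBasis a b c → IsDual χ a b c → ⁅⁅a, b⁆, ⁅a, c⁆⁆ ∈ leftSlot K χ a)
  (H₂ : ∀ a b c χ, IsBasis a b c → IsDual χ a b c → ⁅⁅a, b⁆, ⁅a, c⁆⁆ ∈ leftSlot K χ b)

include H₂

theorem mem_leftSlot_third {a b c : F3} (hb : IsBasis a b c) (hχ : IsDual χ a b c) :
    ⁅⁅a, b⁆, ⁅a, c⁆⁆ ∈ leftSlot K χ c := by
  rw [← commutatorElement_inv]
  exact inv_mem (H₂ _ _ _ _ hb.swap' hχ.swap)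

/-- The transvection takes c⁻¹ac to ac; χ stays dual to both because it vanishes on c. -/
theorem mem_leftSlot_second' {a b c : F3} (hb : IsBasis a b c) (hχ : IsDual χ a b c) :
    ⁅⁅c, b⁆, ⁅a, c⁆⁆ ∈ leftSlot K χ b := by
  have e : c * (c⁻¹ * a * c) = a * c := by group
  have h := commutatorElement_mem_of_transvection VC_le_leftSlot (H₂ _ _ _ _ hb.conj hχ.conj)
    (by rw [e]; exact H₂ _ _ _ _ hb.mul_right hχ.mul_right)
  rwa [show c * (c⁻¹ * a * c) * c⁻¹ = a by group] at h

/-- Replacing b by bc does not change [c, b], so the same element lies in the slots of b and bc,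
hence in that of c. -/
theorem mem_leftSlot_third' {a b c : F3} (hb : IsBasis a b c) (hχ : IsDual χ a b c) :
    ⁅⁅c, b⁆, ⁅a, c⁆⁆ ∈ leftSlot K χ c := by
  have h1 := mem_leftSlot_second' H₂ hb hχ
  have h2 := mem_leftSlot_second' (χ := χ) H₂ hb.swap.mul_right.swap
    ⟨hχ.1, by simp [hχ.2.1, hχ.2.2], hχ.2.2⟩
  rw [show ⁅c, b * c⁆ = ⁅c, b⁆ by simp only [commutatorElement_def]; group] at h2
  simpa using mem_leftSlot_mul (mem_leftSlot_inv h1) h2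

include H₁

theorem mem_leftSlot_first' {a b c : F3} (hb : IsBasis a b c) (hχ : IsDual χ a b c) :
    ⁅⁅c, b⁆, ⁅a, c⁆⁆ ∈ leftSlot K χ a := by
  have e : c * (c⁻¹ * a * c) = a * c := by group
  -- The transvection argument needs one common slot for both bases: ac, the product of c and c⁻¹ac.
  have h1 := mem_leftSlot_mul (mem_leftSlot_third H₂ hb.conj hχ.conj)
    (H₁ _ _ _ _ hb.conj hχ.conj)
  rw [e] at h1
  have h := commutatorElement_mem_of_transvection VC_le_leftSlot h1
    (by rw [e]; exact H₁ _ _ _ _ hb.mul_right hχ.mul_right)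
  rw [show c * (c⁻¹ * a * c) * c⁻¹ = a by group] at h
  simpa using mem_leftSlot_mul h (mem_leftSlot_inv (mem_leftSlot_third' H₂ hb hχ))

theorem mem_leftSlot_all {a b c : F3} (hb : IsBasis a b c) (χ : F3 →* Multiplicative ℤ)
    (y : F3) : ⁅⁅a, c⁆, ⁅b, c⁆⁆ ∈ leftSlot K χ y := by
  have key : ∀ {a b c : F3}, IsBasis a b c → ∀ χ, IsDual χ a b c →
      ⁅⁅c, b⁆, ⁅a, c⁆⁆ ∈ leftSlot K χ y := fun hb χ hχ =>
    mem_leftSlot_of_basis hb (mem_leftSlot_first' H₁ H₂ hb hχ) (mem_leftSlot_second' H₂ hb hχ)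
      (mem_leftSlot_third' H₂ hb hχ) y
  have inv_left : ∀ {u v : F3} {χ}, u ∈ commutator F3 → v ∈ commutator F3 →
      ⁅u, v⁆ ∈ leftSlot K χ y → ⁅u⁻¹, v⁆ ∈ leftSlot K χ y := fun {u v χ} hu hv h =>
    (inv_mem (show u ∈ annihilator _ VC_le_leftSlot v hv from ⟨hu, h⟩)).2
  have comm_right : ∀ {u v : F3} {χ}, ⁅u, v⁆ ∈ leftSlot K χ y → ⁅v, u⁆ ∈ leftSlot K χ y :=
    fun h => by rw [← commutatorElement_inv]; exact inv_mem h
  -- By additivity χ may be taken dual to a, b or c. Duals to a and b are exchanged by swapping the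
  -- two; the dual to c is the hypothesis on the basis (c, a, b), up to signs.
  refine mem_leftSlot_of_dual hb (fun χ hχ => ?_) (fun χ hχ => ?_) (fun χ hχ => ?_) χ
  · have := comm_right (inv_left (commutatorElement_mem _ _) (commutatorElement_mem _ _)
      (key hb χ hχ))
    rwa [commutatorElement_inv] at this
  · have := inv_left (commutatorElement_mem _ _) (commutatorElement_mem _ _)
      (key hb.swap χ hχ)
    rwa [commutatorElement_inv] at this
  · have hb' := hb.swap'.swap
    have h1 := mem_leftSlot_of_basis hb' (H₁ _ _ _ _ hb' hχ) (H₂ _ _ _ _ hb' hχ)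
      (mem_leftSlot_third H₂ hb' hχ) y
    have h2 := comm_right (inv_left (commutatorElement_mem _ _) (commutatorElement_mem _ _) h1)
    have h3 := comm_right (inv_left (commutatorElement_mem _ _)
      (inv_mem (commutatorElement_mem _ _)) h2)
    rwa [commutatorElement_inv, commutatorElement_inv] at h3

/-- `K` contains all twists. -/
theorem twisted_all (χ : F3 →* Multiplicative ℤ) {z : F3} (hz : z ∈ VC) : Twisted K χ z := by
  have h : ∀ w ∈ derivedSeries F3 2, ∀ y, Twisted K χ ⁅w, y⁆ := fun w hw y =>
    (derivedSeries_two_le_of_basis VC_le_leftSlot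
      (fun a b c hb => mem_leftSlot_all H₁ H₂ hb χ y) hw).2
  let Z : Subgroup F3 :=
    { carrier := {z | Twisted K χ z}
      one_mem' := twisted_of_mem_VG (one_mem _)
      mul_mem' := fun ha hb => ha.mul hb
      inv_mem' := fun ha => ha.inv }
  have hZ : VC ≤ Z := commutator_le.mpr fun w hw y _ => h w hw y
  exact hZ hz

end Slots

/-! ### Decomposing H₃ into twists and conclusion -/

theorem natGC_mk (f : F3) : natGC (QuotientGroup.mk' VG f) = QuotientGroup.mk' VC f := rfl

theorem mk_VC_eq_one {f : F3} : QuotientGroup.mk' VC f = 1 ↔ f ∈ VC :=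
  QuotientGroup.eq_one_iff f

theorem mem_H3_iff {θ : MulAut G3} : θ ∈ H3 ↔
    ∀ f, natGC (θ (QuotientGroup.mk' VG f)) = QuotientGroup.mk' VC f := by
  rw [H3, MonoidHom.mem_ker]
  constructor
  · intro h f
    have h1 : phi3 θ (natGC (QuotientGroup.mk' VG f)) = natGC (θ (QuotientGroup.mk' VG f)) :=
      inducedAut_apply _ _ _ _ _
    rw [← h1, h]
    rfl
  · intro h
    ext q
    obtain ⟨f, rfl⟩ := QuotientGroup.mk'_surjective VC q
    have h1 : phi3 θ (natGC (QuotientGroup.mk' VG f)) = natGC (θ (QuotientGroup.mk' VG f)) :=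
      inducedAut_apply _ _ _ _ _
    rw [h f] at h1
    exact h1

theorem IsTwist.mem_H3 {κ : MulAut G3} {χ : F3 →* Multiplicative ℤ} {z : F3} (hz : z ∈ VC)
    (h : IsTwist κ χ z) : κ ∈ H3 := by
  rw [mem_H3_iff]
  intro f
  rw [h, map_mul, map_zpow, natGC_mk, natGC_mk, mk_VC_eq_one.mpr hz, one_zpow, mul_one]

theorem IsTwist.apply_x_self {κ : MulAut G3} {z : F3} {i : Fin 3} (h : IsTwist κ (coord i) z) :
    κ (x i) = x i * QuotientGroup.mk' VG z := by
  have := h (FreeGroup.of i)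
  rwa [coord_self, toAdd_ofAdd, zpow_one] at this

theorem IsTwist.apply_x_ne {κ : MulAut G3} {z : F3} {i j : Fin 3} (h : IsTwist κ (coord i) z)
    (hj : j ≠ i) : κ (x j) = x j := by
  have := h (FreeGroup.of j)
  rwa [coord_ne hj, toAdd_one, zpow_zero, mul_one] at this

theorem mulAut_ext {θ κ : MulAut G3} (h : ∀ i, θ (x i) = κ (x i)) : θ = κ := by
  have : (θ.toMonoidHom.comp (QuotientGroup.mk' VG)) = κ.toMonoidHom.comp (QuotientGroup.mk' VG) :=
    FreeGroup.ext_hom _ _ h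
  ext g
  obtain ⟨f, rfl⟩ := QuotientGroup.mk'_surjective VG g
  exact DFunLike.congr_fun this f

theorem exists_of_mem_H3 {θ : MulAut G3} (h : θ ∈ H3) (i : Fin 3) :
    ∃ z ∈ VC, θ (x i) = x i * QuotientGroup.mk' VG z := by
  obtain ⟨f, hf⟩ := QuotientGroup.mk'_surjective VG (θ (x i))
  have h1 : natGC (θ (x i)) = QuotientGroup.mk' VC (FreeGroup.of i) :=
    mem_H3_iff.mp h (FreeGroup.of i)
  rw [← hf, natGC_mk] at h1
  refine ⟨(FreeGroup.of i)⁻¹ * f, mk_VC_eq_one.mp ?_, ?_⟩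
  · rw [map_mul, map_inv, h1, inv_mul_cancel]
  · rw [← hf, map_mul, map_inv]
    exact (mul_inv_cancel_left _ _).symm

/-- An element of `H3` is the product of three coordinate twists, one per generator; they do not
interfere, as each fixes the other generators and all central factors. -/
theorem H3_le_of_twisted {K : Subgroup (MulAut G3)}
    (hK : ∀ (χ : F3 →* Multiplicative ℤ) (z : F3), z ∈ VC → Twisted K χ z) : H3 ≤ K := by
  intro θ hθ
  choose z hz hx using exists_of_mem_H3 hθ
  have h : ∀ i, ∃ κ ∈ K, IsTwist κ (coord i) (z i) := fun i => (hK (coord i) (z i) (hz i)).2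
  choose κ hκ ht using h
  have e : θ = κ 0 * κ 1 * κ 2 := by
    refine mulAut_ext fun i => ?_
    rw [hx, MulAut.mul_apply, MulAut.mul_apply]
    fin_cases i
    · simp only [Fin.zero_eta]
      rw [(ht 2).apply_x_ne (by decide), (ht 1).apply_x_ne (by decide), (ht 0).apply_x_self]
    · simp only [Fin.mk_one]
      rw [(ht 2).apply_x_ne (by decide), (ht 1).apply_x_self, map_mul,
        (ht 0).apply_x_ne (by decide), (ht 0).mk_of_mem (hz 1)]
    · simp only [Fin.reduceFinMk]
      rw [(ht 2).apply_x_self, map_mul, map_mul, (ht 1).apply_x_ne (by decide),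
        (ht 0).apply_x_ne (by decide), (ht 1).mk_of_mem (hz 2), (ht 0).mk_of_mem (hz 2)]
  rw [e]
  exact mul_mem (mul_mem (hκ 0) (hκ 1)) (hκ 2)

theorem comm_eq {G : Type*} [Group G] (a b : G) : comm a b = ⁅a⁻¹, b⁻¹⁆ := by
  simp [comm, commutatorElement_def]

theorem map_comm {G H : Type*} [Group G] [Group H] (φ : G →* H) (a b : G) :
    φ (comm a b) = comm (φ a) (φ b) := by
  simp [comm]

theorem comm_mem_VC (a b c d : F3) : comm (comm (comm a b) (comm a c)) d ∈ VC := by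
  rw [comm_eq _ d]
  refine commutator_mem_commutator (inv_mem ?_) (mem_top _)
  rw [comm_eq (comm a b)]
  refine commutator_mem_derivedSeries_two (inv_mem ?_) (inv_mem ?_) <;>
  · rw [comm_eq]
    exact commutatorElement_mem _ _

/-- If `K` is invariant under tame conjugation and contains the twist along the first coordinate by
`[[f₀, f₁], [f₀, f₂], fᵢ]`, then it contains the analogous twists for all bases. -/
theorem mem_leftSlot_of_twisted {K : Subgroup (MulAut G3)}
    (hK : ∀ τ, ∀ κ ∈ K, (tame τ)⁻¹ * κ * tame τ ∈ K) (i : Fin 3)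
    (h : Twisted K (coord 0) (comm (comm (comm (FreeGroup.of 0) (FreeGroup.of 1))
      (comm (FreeGroup.of 0) (FreeGroup.of 2))) (FreeGroup.of i)))
    {τ : MulAut F3} {χ : F3 →* Multiplicative ℤ}
    (hχ : IsDual χ (τ (FreeGroup.of 0)) (τ (FreeGroup.of 1)) (τ (FreeGroup.of 2))) :
    ⁅⁅τ (FreeGroup.of 0), τ (FreeGroup.of 1)⁆, ⁅τ (FreeGroup.of 0), τ (FreeGroup.of 2)⁆⁆ ∈
      leftSlot K χ (τ (FreeGroup.of i)) := by
  -- Inverting the generators reconciles a⁻¹b⁻¹ab with Mathlib's aba⁻¹b⁻¹. It also negates the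
  -- character, which `inv_char` undoes.
  have h1 := (h.map hK (τ * inversion)).inv_char
  have e : ((coord 0).comp (τ * inversion)⁻¹.toMonoidHom)⁻¹ = χ := by
    have hb : IsBasis (τ (FreeGroup.of 0)) (τ (FreeGroup.of 1)) (τ (FreeGroup.of 2)) :=
      ⟨τ, rfl, rfl, rfl⟩
    have e1 : ∀ j, ((coord 0).comp (τ * inversion)⁻¹.toMonoidHom)⁻¹ (τ (FreeGroup.of j)) =
        coord 0 (FreeGroup.of j) := by
      intro j
      have e2 : τ (FreeGroup.of j) = (τ * inversion) (FreeGroup.of j)⁻¹ := by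
        simp [inversion_of]
      rw [e2, MonoidHom.inv_apply]
      have e3 : ((coord 0).comp (τ * inversion)⁻¹.toMonoidHom) ((τ * inversion)
          (FreeGroup.of j)⁻¹) = coord 0 (FreeGroup.of j)⁻¹ :=
        congrArg (coord 0) (MulAut.inv_apply_self _ _ _)
      rw [e3, map_inv, inv_inv]
    refine hb.hom_ext ?_ ?_ ?_
    · rw [e1, coord_self, hχ.1]
    · rw [e1, coord_ne (by decide), hχ.2.1]
    · rw [e1, coord_ne (by decide), hχ.2.2]
  rw [e] at h1
  have e4 : ∀ j, (τ * inversion) (FreeGroup.of j) = (τ (FreeGroup.of j))⁻¹ := by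
    intro j
    simp [inversion_of]
  have e5 : (τ * inversion) (comm (comm (comm (FreeGroup.of 0) (FreeGroup.of 1))
      (comm (FreeGroup.of 0) (FreeGroup.of 2))) (FreeGroup.of i)) =
      ⁅⁅⁅τ (FreeGroup.of 0), τ (FreeGroup.of 1)⁆⁻¹,
        ⁅τ (FreeGroup.of 0), τ (FreeGroup.of 2)⁆⁻¹⁆⁻¹, τ (FreeGroup.of i)⁆ := by
    have := map_comm (τ * inversion).toMonoidHom
    simp only [MulEquiv.toMonoidHom_eq_coe, MonoidHom.coe_coe] at this
    simp only [this, e4]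
    simp only [comm_eq, inv_inv]
  rw [e5] at h1
  have m1 := commutatorElement_mem (τ (FreeGroup.of 0)) (τ (FreeGroup.of 1))
  have m2 := commutatorElement_mem (τ (FreeGroup.of 0)) (τ (FreeGroup.of 2))
  have h2 := inv_mem (show _ ∈ leftSlot K χ (τ (FreeGroup.of i)) from
    ⟨inv_mem (commutator_mem_derivedSeries_two (inv_mem m1) (inv_mem m2)), h1⟩)
  rw [inv_inv] at h2
  -- The inverses left on the inner commutators are removed by bilinearity.
  have h3 := mem_annihilator_inv (hv := m2) (hv' := inv_mem m2)
    (show _ ∈ annihilator _ VC_le_leftSlot _ (inv_mem m2) from ⟨inv_mem m1, h2⟩)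
  exact (inv_mem_iff.mp h3).2

end AutG3

open AutG3 in
theorem proposition5 :
    ∃ α₁ α₂ : MulAut AutG3.G3,
      (α₁ (AutG3.x 0) = AutG3.x 0 *
          AutG3.comm (AutG3.comm (AutG3.comm (AutG3.x 0) (AutG3.x 1))
            (AutG3.comm (AutG3.x 0) (AutG3.x 2))) (AutG3.x 0) ∧
        α₁ (AutG3.x 1) = AutG3.x 1 ∧ α₁ (AutG3.x 2) = AutG3.x 2) ∧
      (α₂ (AutG3.x 0) = AutG3.x 0 *
          AutG3.comm (AutG3.comm (AutG3.comm (AutG3.x 0) (AutG3.x 1))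
            (AutG3.comm (AutG3.x 0) (AutG3.x 2))) (AutG3.x 1) ∧
        α₂ (AutG3.x 1) = AutG3.x 1 ∧ α₂ (AutG3.x 2) = AutG3.x 2) ∧
      AutG3.H3 = AutG3.conjClosure {α₁, α₂} AutG3.T3 := by
  have m1 := comm_mem_VC (FreeGroup.of 0) (FreeGroup.of 1) (FreeGroup.of 2) (FreeGroup.of 0)
  have m2 := comm_mem_VC (FreeGroup.of 0) (FreeGroup.of 1) (FreeGroup.of 2) (FreeGroup.of 1)
  obtain ⟨α₁, h1⟩ := exists_isTwist (coord 0) m1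
  obtain ⟨α₂, h2⟩ := exists_isTwist (coord 0) m2
  refine ⟨α₁, α₂, ⟨?_, h1.apply_x_ne (by decide), h1.apply_x_ne (by decide)⟩,
    ⟨?_, h2.apply_x_ne (by decide), h2.apply_x_ne (by decide)⟩, le_antisymm ?_ ?_⟩
  · rw [h1.apply_x_self]
    simp only [map_comm]
    rfl
  · rw [h2.apply_x_self]
    simp only [map_comm]
    rfl
  · have hK : ∀ τ, ∀ κ ∈ conjClosure {α₁, α₂} T3,
        (tame τ)⁻¹ * κ * tame τ ∈ conjClosure {α₁, α₂} T3 :=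
      fun τ κ hκ => conjClosure_conj ⟨τ, rfl⟩ hκ
    have hsub : ∀ α ∈ ({α₁, α₂} : Set (MulAut G3)), α ∈ conjClosure {α₁, α₂} T3 :=
      fun α hα => Subgroup.subset_closure ⟨1, one_mem _, α, hα, by simp⟩
    refine H3_le_of_twisted fun χ z hz => twisted_all ?_ ?_ χ hz
    · rintro a b c χ ⟨τ, rfl, rfl, rfl⟩ hχ
      exact mem_leftSlot_of_twisted hK 0 ⟨m1, α₁, hsub _ (by simp), h1⟩ hχ
    · rintro a b c χ ⟨τ, rfl, rfl, rfl⟩ hχ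
      exact mem_leftSlot_of_twisted hK 1 ⟨m2, α₂, hsub _ (by simp), h2⟩ hχ
  · have hn : H3.Normal := by unfold H3; infer_instance
    rw [conjClosure, Subgroup.closure_le]
    rintro _ ⟨y, -, α, hα, rfl⟩
    have hα' : α ∈ H3 := by
      rcases hα with rfl | rfl
      · exact h1.mem_H3 m1
      · exact h2.mem_H3 m2
    simpa using hn.conj_mem α hα' y⁻¹
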